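/- Let $a<b$ be real numbers and let $\ell^\infty([a,b])$ be the space of all bounded functions $z:[a,b]\to\mathbb{R}$ with the norm $\|z\|=\sup_{t\in[a,b]}|z(t)|$. Let $D$ be a nonempty directed set and, for each $\alpha\in D$, let $(\Omega_\alpha,\mathcal{A}_\alpha,\mathbb{P}_\alpha)$ be a probability space and $X_\alpha:\Omega_\alpha\to\ell^\infty([a,b])$ an arbitrary, not necessarily measurable, map. For $A\subseteq\Omega_\alpha$ write $\mathbb{P}_\alpha^*(A)=\inf\{\mathbb{P}_\alpha(B):B\supseteq A,\ B\in\mathcal{A}_\alpha\}$ and $\mathbb{P}_{\alpha,*}(A)=\sup\{\mathbb{P}_\alpha(B):B\subseteq A,\ B\in\mathcal{A}_\alpha\}$ for the outer and inner probability. A family of maps $Y_\alpha:\Omega_\alpha\to S$, $\alpha\in D$, into a metric space $(S,d)$ is called asymptotically tight if for every $\varepsilon>0$ there is a compact set $K\subseteq S$ such that for every $\delta>0$ $$\liminf_{\alpha}\mathbb{P}_{\alpha,*}(Y_\alpha\in K^\delta)\ge 1-\varepsilon,\qquad K^\delta=\{y\in S: d(y,K)<\delta\}.$$ Suppose that (a)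 for each $t\in[a,b]$ the family of real-valued maps $(X_\alpha(t))_{\alpha\in D}$ is asymptotically tight in $\mathbb{R}$; and (b) for every $\eta>0$, $$\lim_{\delta\downarrow 0}\ \sup_{s\in[a,b]}\ \limsup_{\alpha}\ \frac1\delta\,\mathbb{P}_\alpha^*\Big(\sup_{t\in[a,b],\ s-\delta<t<s+\delta}|X_\alpha(s)-X_\alpha(t)|>\eta\Big)=0 .$$ Then $(X_\alpha)_{\alpha\in D}$ is asymptotically tight in $\ell^\infty([a,b])$. -/

import Mathlib

open Filter Topology MeasureTheory
open scoped ENNReal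

/-- `ℓ^∞([a,b])`: all bounded real functions on `[a,b]`, with the supremum norm. -/
abbrev EllInfty (a b : ℝ) : Type :=
  lp (fun _ : Set.Icc a b => ℝ) ∞

/-- Outer probability `P^*(A)` of an arbitrary set: the infimum of the probabilities of the
measurable sets containing `A` (this is the value that Mathlib's `P` takes on any set). -/
noncomputable def outerProb {Ω : Type*} [MeasurableSpace Ω] (P : Measure Ω) (A : Set Ω) : ℝ≥0∞ :=
  ⨅ (B : Set Ω) (_ : A ⊆ B) (_ : MeasurableSet B), P B

/-- Inner probability `P_*(A)` of an arbitrary set: the supremum of the probabilities of the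
measurable sets contained in `A`. -/
noncomputable def innerProb {Ω : Type*} [MeasurableSpace Ω] (P : Measure Ω) (A : Set Ω) : ℝ≥0∞ :=
  ⨆ (B : Set Ω) (_ : B ⊆ A) (_ : MeasurableSet B), P B

theorem outerProb_eq {Ω : Type*} [MeasurableSpace Ω] (P : Measure Ω) (A : Set Ω) :
    outerProb P A = P A :=
  (measure_eq_iInf A).symm

theorem innerProb_eq {Ω : Type*} [MeasurableSpace Ω] (P : Measure Ω) [IsProbabilityMeasure P]
    (A : Set Ω) : innerProb P A = 1 - P Aᶜ := by
  apply le_antisymm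
  · refine iSup_le fun B => iSup_le fun hBA => iSup_le fun hB => ?_
    have h : P B = 1 - P Bᶜ := by
      have := prob_compl_eq_one_sub (μ := P) hB.compl
      rwa [compl_compl] at this
    rw [h]
    exact tsub_le_tsub_left (measure_mono (Set.compl_subset_compl.2 hBA)) 1
  · have hC : MeasurableSet (toMeasurable P Aᶜ)ᶜ := (measurableSet_toMeasurable P Aᶜ).compl
    have hCA : (toMeasurable P Aᶜ)ᶜ ⊆ A := Set.compl_subset_comm.1 (subset_toMeasurable P Aᶜ)
    have h := prob_compl_eq_one_sub (μ := P) (measurableSet_toMeasurable P Aᶜ)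
    rw [measure_toMeasurable] at h
    rw [← h]
    exact le_iSup_of_le _ (le_iSup_of_le hCA (le_iSup_of_le hC le_rfl))

/-- Asymptotic tightness of a net of arbitrary (not necessarily measurable) maps into a metric
space: for every `ε > 0` there is a compact `K` such that for every `δ > 0`,
`liminf_α P_*(X_α ∈ K^δ) ≥ 1 - ε`, where `K^δ = {y | d(y, K) < δ}`. -/
def AsymptoticallyTight {D : Type*} [Preorder D] {Ω : D → Type*} [∀ α, MeasurableSpace (Ω α)]
    (P : ∀ α, Measure (Ω α)) {S : Type*} [PseudoMetricSpace S] (X : ∀ α, Ω α → S) : Prop :=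
  ∀ ε : ℝ, 0 < ε → ∃ K : Set S, IsCompact K ∧ ∀ δ : ℝ, 0 < δ →
    1 - ENNReal.ofReal ε ≤
      liminf (fun α => innerProb (P α) {ω | X α ω ∈ Metric.thickening δ K}) atTop

/-- The local oscillation `sup_{s-δ<t<s+δ, t ∈ [a,b]} |z(s) - z(t)|` of a bounded function; for
`δ > 0` this is the supremum of a nonempty bounded set of reals. -/
noncomputable def localOsc {a b : ℝ} (z : EllInfty a b) (s : Set.Icc a b) (δ : ℝ) : ℝ :=
  ⨆ t : {t : Set.Icc a b // (s : ℝ) - δ < t ∧ (t : ℝ) < s + δ}, |z s - z t.1|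

/-- The functions bounded by `M` on the range of `π` that `z ↦ z ∘ π` approximates within `η`. -/
def approxSet {a b : ℝ} (π : Set.Icc a b → Set.Icc a b) (η M : ℝ) : Set (EllInfty a b) :=
  {z | ∀ t, |z t - z (π t)| ≤ η ∧ |z (π t)| ≤ M}

theorem EllInfty.abs_apply_le_norm {a b : ℝ} (z : EllInfty a b) (t : Set.Icc a b) :
    |z t| ≤ ‖z‖ :=
  lp.norm_apply_le_norm ENNReal.top_ne_zero z t

theorem EllInfty.continuous_apply {a b : ℝ} (t : Set.Icc a b) :
    Continuous fun z : EllInfty a b => z t := by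
  refine (LipschitzWith.of_dist_le_mul (K := 1) fun z w => ?_).continuous
  rw [NNReal.coe_one, one_mul, dist_eq_norm z w]
  exact EllInfty.abs_apply_le_norm (z - w) t

theorem isClosed_approxSet {a b : ℝ} (π : Set.Icc a b → Set.Icc a b) (η M : ℝ) :
    IsClosed (approxSet π η M) := by
  simp only [approxSet, Set.ofPred_forall, Set.ofPred_and]
  refine isClosed_iInter fun t => IsClosed.inter ?_ ?_
  · exact isClosed_le ((EllInfty.continuous_apply t).sub
      (EllInfty.continuous_apply (π t))).abs continuous_const
  · exact isClosed_le (EllInfty.continuous_apply (π t)).abs continuous_const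

/-- An ultrafilter containing `approxSet π η M`, where `π` has finite range, contains a set of
diameter at most `4 * η`. -/
theorem exists_mem_ultrafilter_dist_le {a b : ℝ} {π : Set.Icc a b → Set.Icc a b}
    (hπ : (Set.range π).Finite) {η M : ℝ} (hη : 0 < η) {U : Ultrafilter (EllInfty a b)}
    (hU : approxSet π η M ∈ U) :
    ∃ V ∈ U, ∀ z ∈ V, ∀ w ∈ V, dist z w ≤ 4 * η := by
  have := hπ.fintype
  let R : EllInfty a b → (Set.range π → ℝ) := fun z s => z s
  have hR : Set.Icc (fun _ => -M) (fun _ => M) ∈ U.map R := by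
    refine Ultrafilter.mem_map.2 (Filter.mem_of_superset hU fun z hz => ⟨?_, ?_⟩) <;> rintro ⟨_, t, rfl⟩
    · exact (abs_le.1 (hz t).2).1
    · exact (abs_le.1 (hz t).2).2
  obtain ⟨x, -, hx⟩ := isCompact_Icc.ultrafilter_le_nhds' (U.map R) hR
  refine ⟨R ⁻¹' Metric.ball x η ∩ approxSet π η M,
    Filter.inter_mem (hx (Metric.ball_mem_nhds x hη)) hU, ?_⟩
  rintro z ⟨hzx, hz⟩ w ⟨hwx, hw⟩
  rw [dist_eq_norm]
  refine lp.norm_le_of_forall_le (by positivity) fun t => ?_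
  have h₁ := (dist_le_pi_dist (R z) x ⟨π t, t, rfl⟩).trans_lt hzx
  have h₂ := (dist_le_pi_dist (R w) x ⟨π t, t, rfl⟩).trans_lt hwx
  have h₃ := (hz t).1
  have h₄ := (hw t).1
  rw [Real.dist_eq, abs_lt] at h₁ h₂
  rw [abs_le] at h₃ h₄
  change |z t - w t| ≤ 4 * η
  simp only [R] at h₁ h₂
  rw [abs_le]
  constructor <;> linarith [h₁.1, h₁.2, h₂.1, h₂.2, h₃.1, h₃.2, h₄.1, h₄.2]

section Compactness

variable {a b : ℝ} {π : ℕ → Set.Icc a b → Set.Icc a b} {η M : ℕ → ℝ}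

theorem exists_ultrafilter_le_nhds_of_approxSet_mem (hπ : ∀ m, (Set.range (π m)).Finite)
    (hη : ∀ m, 0 < η m) (hη₀ : Tendsto η atTop (𝓝 0)) {U : Ultrafilter (EllInfty a b)}
    (hU : ∀ m, approxSet (π m) (η m) (M m) ∈ U) :
    ∃ z ∈ ⋂ m, approxSet (π m) (η m) (M m), (U : Filter (EllInfty a b)) ≤ 𝓝 z := by
  have hc : Cauchy (U : Filter (EllInfty a b)) := by
    refine Metric.cauchy_iff.2 ⟨U.neBot, fun ε hε => ?_⟩
    obtain ⟨m, hm⟩ := (hη₀.eventually_lt_const (by positivity : 0 < ε / 4)).exists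
    obtain ⟨V, hV, h⟩ := exists_mem_ultrafilter_dist_le (hπ m) (hη m) (hU m)
    exact ⟨V, hV, fun z hz w hw => (h z hz w hw).trans_lt (by linarith)⟩
  obtain ⟨z, hz⟩ := CompleteSpace.complete hc
  exact ⟨z, Set.mem_iInter.2 fun m =>
    (isClosed_approxSet _ _ _).mem_of_frequently_of_tendsto
      (Filter.Eventually.frequently (hU m)) (tendsto_id.mono_right hz), hz⟩

theorem isCompact_iInter_approxSet (hπ : ∀ m, (Set.range (π m)).Finite)
    (hη : ∀ m, 0 < η m) (hη₀ : Tendsto η atTop (𝓝 0)) :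
    IsCompact (⋂ m, approxSet (π m) (η m) (M m)) := by
  refine isCompact_iff_ultrafilter_le_nhds'.2 fun U hU => ?_
  exact exists_ultrafilter_le_nhds_of_approxSet_mem hπ hη hη₀ fun m =>
    Filter.mem_of_superset hU (Set.iInter_subset _ m)

/-- Finitely many of the sets already confine to a given neighbourhood of the intersection. -/
theorem exists_mem_thickening_iInter_approxSet (hπ : ∀ m, (Set.range (π m)).Finite)
    (hη : ∀ m, 0 < η m) (hη₀ : Tendsto η atTop (𝓝 0)) {δ : ℝ} (hδ : 0 < δ) :
    ∃ n : ℕ, ∀ z, (∀ m < n, z ∈ approxSet (π m) (η m) (M m)) →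
      z ∈ Metric.thickening δ (⋂ m, approxSet (π m) (η m) (M m)) := by
  by_contra! h
  choose z hz hzK using h
  let U : Ultrafilter (EllInfty a b) := (Filter.hyperfilter ℕ).map z
  have hle : (Filter.hyperfilter ℕ : Filter ℕ) ≤ atTop := Nat.hyperfilter_le_atTop
  have hU : ∀ m, approxSet (π m) (η m) (M m) ∈ U := fun m =>
    hle ((eventually_gt_atTop m).mono fun n hn => hz n m hn)
  obtain ⟨x, hx, hUx⟩ := exists_ultrafilter_le_nhds_of_approxSet_mem hπ hη hη₀ hU
  have hmem : Metric.thickening δ (⋂ m, approxSet (π m) (η m) (M m)) ∈ U :=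
    hUx (Metric.isOpen_thickening.mem_nhds (Metric.self_subset_thickening hδ _ hx))
  obtain ⟨n, hn⟩ := Filter.nonempty_of_mem (f := (Filter.hyperfilter ℕ : Filter ℕ)) hmem
  exact hzK n hn

end Compactness

theorem abs_sub_le_localOsc {a b : ℝ} (z : EllInfty a b) {s t : Set.Icc a b} {δ : ℝ}
    (h₁ : (s : ℝ) - δ < t) (h₂ : (t : ℝ) < s + δ) : |z s - z t| ≤ localOsc z s δ := by
  refine le_ciSup (f := fun t : {t : Set.Icc a b // (s : ℝ) - δ < t ∧ (t : ℝ) < s + δ} =>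
    |z s - z t.1|) ⟨‖z‖ + ‖z‖, ?_⟩ ⟨t, h₁, h₂⟩
  rintro _ ⟨u, rfl⟩
  exact (abs_sub _ _).trans
    (add_le_add (EllInfty.abs_apply_le_norm z s) (EllInfty.abs_apply_le_norm z u.1))

theorem exists_finset_Icc_cover {a b δ : ℝ} (hab : a < b) (hδ : 0 < δ) :
    ∃ F : Finset (Set.Icc a b), F.card * δ ≤ b - a + δ ∧
      ∀ t : Set.Icc a b, ∃ s ∈ F, (s : ℝ) - δ < t ∧ (t : ℝ) < s + δ := by
  classical
  refine ⟨(Finset.range (⌊(b - a) / δ⌋₊ + 1)).image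
    fun i : ℕ => Set.projIcc a b hab.le (a + i * δ), ?_, fun t => ?_⟩
  · have h₁ : (((Finset.range (⌊(b - a) / δ⌋₊ + 1)).image
        fun i : ℕ => Set.projIcc a b hab.le (a + i * δ)).card : ℝ) ≤ ⌊(b - a) / δ⌋₊ + 1 := by
      exact_mod_cast Finset.card_image_le.trans_eq (Finset.card_range _)
    have h₂ : (⌊(b - a) / δ⌋₊ : ℝ) ≤ (b - a) / δ :=
      Nat.floor_le (div_nonneg (sub_nonneg.2 hab.le) hδ.le)
    calc _ ≤ ((b - a) / δ + 1) * δ := by gcongr; linarith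
      _ = b - a + δ := by field_simp
  · have ht₁ := t.2.1
    have ht₂ := t.2.2
    have hi : (⌊((t : ℝ) - a) / δ⌋₊ : ℝ) * δ ≤ t - a :=
      (le_div_iff₀ hδ).1 (Nat.floor_le (div_nonneg (sub_nonneg.2 ht₁) hδ.le))
    have hi' : (t : ℝ) - a < (⌊((t : ℝ) - a) / δ⌋₊ + 1) * δ :=
      (div_lt_iff₀ hδ).1 (Nat.lt_floor_add_one _)
    have hp : 0 ≤ (⌊((t : ℝ) - a) / δ⌋₊ : ℝ) * δ := by positivity
    refine ⟨_, Finset.mem_image_of_mem _ (Finset.mem_range.2 (Nat.lt_succ_of_le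
      (Nat.floor_le_floor (a := ((t : ℝ) - a) / δ) (by gcongr)))), ?_⟩
    rw [Set.projIcc_of_mem hab.le (x := a + ⌊((t : ℝ) - a) / δ⌋₊ * δ)
      ⟨by linarith, by linarith⟩]
    constructor <;> dsimp only <;> linarith

section Probability

variable {D : Type*} [Preorder D] {Ω : D → Type*} [∀ α, MeasurableSpace (Ω α)]
  {P : ∀ α, Measure (Ω α)}

theorem AsymptoticallyTight.exists_eventually_measure_lt_abs_le [∀ α, IsProbabilityMeasure (P α)]
    {Y : ∀ α, Ω α → ℝ}
    (hY : AsymptoticallyTight P Y) {ε : ℝ≥0∞} (hε : ε ≠ 0) :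
    ∃ M : ℝ, ∀ᶠ α in atTop, P α {ω | M < |Y α ω|} ≤ ε := by
  rcases le_or_gt 1 ε with h1 | h1
  · exact ⟨0, Eventually.of_forall fun α => prob_le_one.trans h1⟩
  have htop : ε ≠ ∞ := (h1.trans ENNReal.one_lt_top).ne
  have hε' : 0 < ε.toReal := ENNReal.toReal_pos hε htop
  obtain ⟨K, hK, h⟩ := hY (ε.toReal / 2) (by positivity)
  obtain ⟨r, hr⟩ := hK.isBounded.subset_closedBall 0
  have hlt : ENNReal.ofReal (ε.toReal / 2) < ε := by
    rw [ENNReal.ofReal_lt_iff_lt_toReal (by positivity) htop]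
    linarith
  have hsub : 1 - ε < 1 - ENNReal.ofReal (ε.toReal / 2) := by
    refine ENNReal.sub_lt_of_lt_add h1.le ?_
    calc (1 : ℝ≥0∞) = 1 - ENNReal.ofReal (ε.toReal / 2) + ENNReal.ofReal (ε.toReal / 2) :=
          (tsub_add_cancel_of_le (hlt.trans h1).le).symm
      _ < _ := ENNReal.add_lt_add_left (ENNReal.sub_ne_top ENNReal.one_ne_top) hlt
  refine ⟨r + 1, ?_⟩
  have hev := Filter.eventually_lt_of_lt_liminf
    (hsub.trans_le (h 1 one_pos))
  filter_upwards [hev] with α hα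
  rw [innerProb_eq] at hα
  have hα' := lt_of_tsub_lt_tsub_left hα
  refine (measure_mono fun ω hω hmem => ?_).trans hα'.le
  obtain ⟨y, hy, hd⟩ := Metric.mem_thickening_iff.1 hmem
  have hy' := hr hy
  rw [mem_closedBall_zero_iff, Real.norm_eq_abs] at hy'
  rw [Real.dist_eq] at hd
  have := abs_sub_abs_le_abs_sub (Y α ω) y
  simp only [Set.mem_ofPred_eq] at hω
  linarith

/-- Uniform smallness of the local oscillations gives, with high probability, a uniform
approximation by finitely many values. -/
theorem exists_finite_range_eventually_measure_le {a b : ℝ} (hab : a < b)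
    {X : ∀ α, Ω α → EllInfty a b} {η : ℝ}
    (hosc : Tendsto
        (fun δ : ℝ => ⨆ s : Set.Icc a b,
          limsup (fun α => (ENNReal.ofReal δ)⁻¹ *
            outerProb (P α) {ω | η < localOsc (X α ω) s δ}) atTop)
        (𝓝[>] 0) (𝓝 0)) {ε : ℝ} (hε : 0 < ε) :
    ∃ π : Set.Icc a b → Set.Icc a b, (Set.range π).Finite ∧
      ∀ᶠ α in atTop, P α {ω | ∃ t, η < |X α ω t - X α ω (π t)|} ≤ ENNReal.ofReal ε := by
  have hL : 0 < b - a + 1 := by linarith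
  have hc : 0 < ε / (b - a + 1) := by positivity
  obtain ⟨δ, hδc, hδ0, hδ1⟩ := ((hosc.eventually_lt_const (ENNReal.ofReal_pos.2 hc)).and
    (Ioo_mem_nhdsGT (zero_lt_one' ℝ))).exists
  obtain ⟨F, hFcard, hF⟩ := exists_finset_Icc_cover hab hδ0
  choose π hπF hπ₁ hπ₂ using hF
  refine ⟨π, F.finite_toSet.subset (Set.range_subset_iff.2 hπF), ?_⟩
  have hev : ∀ᶠ α in atTop, ∀ s ∈ F, P α {ω | η < localOsc (X α ω) s δ} ≤
      ENNReal.ofReal δ * ENNReal.ofReal (ε / (b - a + 1)) := by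
    refine (Filter.eventually_all_finset F).2 fun s _ => ?_
    filter_upwards [Filter.eventually_lt_of_limsup_lt ((le_iSup _ s).trans_lt hδc)] with α hα
    rw [outerProb_eq] at hα
    exact (ENNReal.inv_mul_le_iff (ENNReal.ofReal_pos.2 hδ0).ne' ENNReal.ofReal_ne_top).1 hα.le
  filter_upwards [hev] with α hα
  calc P α {ω | ∃ t, η < |X α ω t - X α ω (π t)|}
      ≤ P α (⋃ s ∈ F, {ω | η < localOsc (X α ω) s δ}) := by
        refine measure_mono ?_
        rintro ω ⟨t, ht⟩
        rw [abs_sub_comm] at ht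
        exact Set.mem_biUnion (hπF t) (ht.trans_le (abs_sub_le_localOsc _ (hπ₁ t) (hπ₂ t)))
    _ ≤ ∑ s ∈ F, P α {ω | η < localOsc (X α ω) s δ} := measure_biUnion_finset_le _ _
    _ ≤ F.card • (ENNReal.ofReal δ * ENNReal.ofReal (ε / (b - a + 1))) :=
        Finset.sum_le_card_nsmul _ _ _ hα
    _ = ENNReal.ofReal (F.card * δ * (ε / (b - a + 1))) := by
        rw [nsmul_eq_mul, ENNReal.ofReal_mul (by positivity), ENNReal.ofReal_mul (by positivity),
          ENNReal.ofReal_natCast, mul_assoc]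
    _ ≤ ENNReal.ofReal ε := by
        refine ENNReal.ofReal_le_ofReal ?_
        calc F.card * δ * (ε / (b - a + 1)) ≤ (b - a + 1) * (ε / (b - a + 1)) := by
              gcongr; linarith
          _ = ε := by field_simp

theorem exists_approxSet_eventually_measure_le [∀ α, IsProbabilityMeasure (P α)]
    {a b : ℝ} (hab : a < b)
    {X : ∀ α, Ω α → EllInfty a b}
    (hmarg : ∀ t : Set.Icc a b, AsymptoticallyTight P (fun α ω => X α ω t)) {η : ℝ}
    (hosc : Tendsto
        (fun δ : ℝ => ⨆ s : Set.Icc a b,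
          limsup (fun α => (ENNReal.ofReal δ)⁻¹ *
            outerProb (P α) {ω | η < localOsc (X α ω) s δ}) atTop)
        (𝓝[>] 0) (𝓝 0)) {ε : ℝ} (hε : 0 < ε) :
    ∃ (π : Set.Icc a b → Set.Icc a b) (M : ℝ), (Set.range π).Finite ∧
      ∀ᶠ α in atTop, P α {ω | X α ω ∉ approxSet π η M} ≤ ENNReal.ofReal ε := by
  obtain ⟨π, hπ, hev⟩ := exists_finite_range_eventually_measure_le hab hosc (half_pos hε)
  have hpos : ENNReal.ofReal (ε / 2) ≠ 0 := (ENNReal.ofReal_pos.2 (half_pos hε)).ne'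
  obtain ⟨ε', hε'0, hε'⟩ : ∃ ε' : ℝ≥0∞, ε' ≠ 0 ∧
      hπ.toFinset.card • ε' ≤ ENNReal.ofReal (ε / 2) := by
    refine ⟨ENNReal.ofReal (ε / 2) / hπ.toFinset.card,
      (ENNReal.div_pos hpos (ENNReal.natCast_ne_top _)).ne', ?_⟩
    rw [nsmul_eq_mul]
    exact ENNReal.mul_div_le
  choose M hM using fun t => (hmarg t).exists_eventually_measure_lt_abs_le hε'0
  obtain ⟨M₀, hM₀⟩ := (hπ.image M).bddAbove
  refine ⟨π, M₀, hπ, ?_⟩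
  filter_upwards [hev, (Filter.eventually_all_finset hπ.toFinset).2 fun t _ => hM t]
    with α h₁ h₂
  calc P α {ω | X α ω ∉ approxSet π η M₀}
      ≤ P α ({ω | ∃ t, η < |X α ω t - X α ω (π t)|} ∪
          ⋃ s ∈ hπ.toFinset, {ω | M s < |X α ω s|}) := by
        refine measure_mono fun ω hω => ?_
        simp only [approxSet, Set.mem_ofPred_eq, not_forall, not_and_or, not_le] at hω
        obtain ⟨t, ht | ht⟩ := hω
        · exact Or.inl ⟨t, ht⟩
        · refine Or.inr (Set.mem_biUnion (x := π t) (by simp) ?_)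
          exact (hM₀ (Set.mem_image_of_mem M (Set.mem_range_self t))).trans_lt ht
    _ ≤ ENNReal.ofReal (ε / 2) + ENNReal.ofReal (ε / 2) := by
        refine (measure_union_le _ _).trans (add_le_add h₁ ?_)
        exact (measure_biUnion_finset_le _ _).trans
          ((Finset.sum_le_card_nsmul _ _ _ h₂).trans hε')
    _ = ENNReal.ofReal ε := by
        rw [← ENNReal.ofReal_add (by positivity) (by positivity), add_halves]

end Probability

theorem mainTheorem1 {a b : ℝ} (hab : a < b)
    {D : Type*} [Preorder D] [IsDirected D (· ≤ ·)] [Nonempty D]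
    {Ω : D → Type*} [∀ α, MeasurableSpace (Ω α)]
    (P : ∀ α, Measure (Ω α)) [∀ α, IsProbabilityMeasure (P α)]
    (X : ∀ α, Ω α → EllInfty a b)
    (hmarg : ∀ t : Set.Icc a b, AsymptoticallyTight P (fun α ω => X α ω t))
    (hosc : ∀ η : ℝ, 0 < η →
      Tendsto
        (fun δ : ℝ => ⨆ s : Set.Icc a b,
          limsup (fun α => (ENNReal.ofReal δ)⁻¹ *
            outerProb (P α) {ω | η < localOsc (X α ω) s δ}) atTop)
        (𝓝[>] 0) (𝓝 0)) :
    AsymptoticallyTight P X := by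
  intro ε hε
  obtain ⟨e, he0, hesum⟩ := ENNReal.exists_pos_sum_of_countable
    (ENNReal.ofReal_pos.2 hε).ne' ℕ
  have hη : ∀ m : ℕ, 0 < 1 / ((m : ℝ) + 1) := fun m => Nat.one_div_pos_of_nat
  choose π M hπ hev using fun m : ℕ =>
    exists_approxSet_eventually_measure_le hab hmarg (hosc _ (hη m)) (NNReal.coe_pos.2 (he0 m))
  refine ⟨_, isCompact_iInter_approxSet (M := M) hπ hη tendsto_one_div_add_atTop_nhds_zero_nat,
    fun δ hδ => ?_⟩
  obtain ⟨n, hn⟩ := exists_mem_thickening_iInter_approxSet (M := M) hπ hη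
    tendsto_one_div_add_atTop_nhds_zero_nat hδ
  refine Filter.le_liminf_of_le (by isBoundedDefault) ?_
  filter_upwards [(Filter.eventually_all_finset (Finset.range n)).2 fun m _ => hev m] with α hα
  rw [innerProb_eq]
  refine tsub_le_tsub_left ?_ 1
  calc P α {ω | X α ω ∈ Metric.thickening δ _}ᶜ
      ≤ P α (⋃ m ∈ Finset.range n, {ω | X α ω ∉ approxSet (π m) (1 / ((m : ℝ) + 1)) (M m)}) := by
        refine measure_mono fun ω hω => ?_
        by_contra hcon
        simp only [Set.mem_iUnion, Set.mem_ofPred_eq, not_exists, not_not] at hcon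
        exact hω (hn _ fun m hm => hcon m (Finset.mem_range.2 hm))
    _ ≤ ∑ m ∈ Finset.range n, (e m : ℝ≥0∞) := by
        refine (measure_biUnion_finset_le _ _).trans (Finset.sum_le_sum fun m hm => ?_)
        simpa only [ENNReal.ofReal_coe_nnreal] using hα m hm
    _ ≤ ENNReal.ofReal ε := (ENNReal.sum_le_tsum _).trans hesum.le
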